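/- A permutation is called separable if it avoids the patterns $2413$ and $3142$. For $n\ge 0$ let $a_n$ be the number of separable permutations of $\{1,\dots,n\}$ (so $a_0=1$, counting the empty permutation), and let $S(x)=\sum_{n\ge 0}a_nx^n\in\mathbb{Q}[[x]]$ be their ordinary generating function. Then $$S(x)^2-(3-x)S(x)+2=0,$$ and $$S(x)=\tfrac12\Big(3-x-\sqrt{x^2-6x+1}\,\Big),$$ where $\sqrt{x^2-6x+1}$ denotes the unique formal power series with constant term $1$ whose square is $x^2-6x+1$. Moreover, $a_0=1$ and $a_{n+1}=r_n$ for every $n\ge 0$, where $(r_n)_{n\ge0}=1,2,6,22,90,394,\dots$ is the sequence of large Schröder numbers, defined by $r_0=1$ and $r_{n+1}=r_n+\sum_{i=0}^{n}r_ir_{n-i}$. -/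

import Mathlib

/-- The word `p` of length `k` (a pattern in one-line notation) occurs in the permutation `σ` of
`n` letters: some subsequence of the one-line notation of `σ` is in the same relative order
as `p`. -/
def ContainsPattern {k n : ℕ} (p : Fin k → ℕ) (σ : Equiv.Perm (Fin n)) : Prop :=
  ∃ f : Fin k → Fin n, StrictMono f ∧ ∀ i j : Fin k, σ (f i) < σ (f j) ↔ p i < p j

/-- The permutations of `n` letters that avoid every pattern in `P`. -/
def avoiders {k : ℕ} (n : ℕ) (P : Set (Fin k → ℕ)) : Set (Equiv.Perm (Fin n)) :=
  {σ | ∀ p ∈ P, ¬ ContainsPattern p σ}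

/-- The separable permutations of `n` letters: those avoiding `2413` and `3142`. -/
def separablePerms (n : ℕ) : Set (Equiv.Perm (Fin n)) :=
  avoiders n {![2, 4, 1, 3], ![3, 1, 4, 2]}

/-- The ordinary generating function of the separable permutations, counted by size and
including the empty permutation. -/
noncomputable def separableGF : PowerSeries ℚ :=
  PowerSeries.mk fun n => ((separablePerms n).ncard : ℚ)

/-- `R` is the square root of the formal power series `F` with constant term `1`. -/
def IsPrincipalSqrt (R F : PowerSeries ℚ) : Prop :=
  R ^ 2 = F ∧ PowerSeries.constantCoeff R = 1

/-! A separable permutation of at least two letters is a direct sum or a skew sum, never both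
(`IsSeparableWord.exists_cut`, `not_isSumCut_neg_of_isSumCut`). Complementation exchanges the two
kinds, so for `n ≥ 2` exactly half of the `a n` separable permutations are sum-indecomposable.
Cutting at the first possible place writes a direct sum uniquely as an indecomposable separable
permutation followed by an arbitrary nonempty separable one (`ncard_firstSumCut`). Together these
give the Schröder recurrence for `a (n + 1)`. Hence `S = 1 + x * r` with `r = 1 + x * r + x * r ^
2`, which yields the quadratic; completing the square gives the closed form. -/

open Equiv

/-! ### Splitting separable words -/

/-- The values `w i`, `w j`, `w k`, `w l` at positions `i < j < k < l < n` never form one of the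
patterns `2413` and `3142`. -/
def IsSeparableWord (w : ℕ → ℤ) (n : ℕ) : Prop :=
  ∀ i j k l, i < j → j < k → k < l → l < n →
    ¬ (w k < w i ∧ w i < w l ∧ w l < w j) ∧ ¬ (w j < w l ∧ w l < w i ∧ w i < w k)

/-- All letters of `w` before position `c` are smaller than those in positions `c, …, n - 1`. -/
def IsSumCut (w : ℕ → ℤ) (n c : ℕ) : Prop :=
  0 < c ∧ c < n ∧ ∀ i j, i < c → c ≤ j → j < n → w i < w j

/-- The first position at which the word splits as a direct sum. -/
def IsFirstSumCut (w : ℕ → ℤ) (n c : ℕ) : Prop :=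
  IsSumCut w n c ∧ ∀ c' < c, ¬ IsSumCut w n c'

/-- Negation exchanges `2413` and `3142`; skew cuts can thus be handled as sum cuts of `-w`. -/
theorem IsSeparableWord.neg {w : ℕ → ℤ} {n : ℕ} (h : IsSeparableWord w n) :
    IsSeparableWord (fun i => -w i) n := by
  intro i j k l hij hjk hkl hl
  have := h i j k l hij hjk hkl hl
  constructor <;> rintro ⟨h1, h2, h3⟩
  · exact this.2 ⟨by linarith, by linarith, by linarith⟩
  · exact this.1 ⟨by linarith, by linarith, by linarith⟩

theorem IsSeparableWord.mono {w : ℕ → ℤ} {m n : ℕ} (h : IsSeparableWord w n) (hmn : m ≤ n) :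
    IsSeparableWord w m :=
  fun i j k l hij hjk hkl hl => h i j k l hij hjk hkl (hl.trans_le hmn)

theorem exists_isFirstSumCut {w : ℕ → ℤ} {n c : ℕ} (h : IsSumCut w n c) :
    ∃ k, IsFirstSumCut w n k := by
  classical
  exact ⟨Nat.find ⟨c, h⟩, Nat.find_spec ⟨c, h⟩, fun _ hc => Nat.find_min ⟨c, h⟩ hc⟩

theorem IsFirstSumCut.unique {w : ℕ → ℤ} {n c d : ℕ} (hc : IsFirstSumCut w n c)
    (hd : IsFirstSumCut w n d) : c = d := by
  rcases lt_trichotomy c d with h | h | h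
  · exact absurd hc.1 (hd.2 c h)
  · exact h
  · exact absurd hd.1 (hc.2 d h)

/-- A separable word that splits as a direct sum still splits, as a direct or as a skew sum, after
a new letter has been appended. -/
theorem exists_cut_succ_of_isSumCut {w : ℕ → ℤ} {n c : ℕ} (hs : IsSeparableWord w (n + 1))
    (hw : ∀ i < n, w i ≠ w n) (h : IsSumCut w n c) :
    (∃ c, IsSumCut w (n + 1) c) ∨ ∃ c, IsSumCut (fun i => -w i) (n + 1) c := by
  classical
  obtain ⟨k, ⟨hk0, hkn, hk⟩, hmin⟩ := exists_isFirstSumCut h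
  by_cases hbelow : ∀ i < k, w i < w n
  · refine Or.inl ⟨k, hk0, by omega, fun i j hi hkj hj => ?_⟩
    rcases Nat.lt_succ_iff_lt_or_eq.mp hj with hj | rfl
    · exact hk i j hi hkj hj
    · exact hbelow i hi
  by_cases habove : ∀ i < k, w n < w i
  · refine Or.inr ⟨n, by omega, by omega, fun i j hi hnj hj => ?_⟩
    obtain rfl : j = n := by omega
    rcases lt_or_ge i k with hik | hik
    · exact neg_lt_neg (habove i hik)
    · exact neg_lt_neg ((habove 0 hk0).trans (hk 0 i hk0 hik hi))
  -- The new letter now falls strictly between values of the first block; `d` will be the first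
  -- position of that block lying above it.
  exfalso
  push Not at hbelow habove
  obtain ⟨j, hj, hjn⟩ := habove
  have hjn' : w j < w n := lt_of_le_of_ne hjn (hw j (by omega))
  have hex : ∃ i, i < k ∧ w n < w i := by
    obtain ⟨i, hi, hin⟩ := hbelow
    exact ⟨i, hi, lt_of_le_of_ne hin (hw i (by omega)).symm⟩
  obtain ⟨hd, hdn⟩ := Nat.find_spec hex
  have hdmin : ∀ i < Nat.find hex, w i < w n := fun i hi => by
    have := Nat.find_min hex hi
    push Not at this
    exact lt_of_le_of_ne (this (hi.trans hd)) (hw i (by omega))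
  set d := Nat.find hex
  -- Otherwise positions `d, i, k, n` form `3142`. So `d` is a sum cut earlier than `k`.
  have hupper : ∀ i, d ≤ i → i < k → w n < w i := fun i hdi hik => by
    by_contra hcon
    have hlt : w i < w n := lt_of_le_of_ne (not_lt.mp hcon) (hw i (by omega))
    have hne : d ≠ i := fun h => by rw [h] at hdn; exact hcon hdn
    exact (hs d i k n (by omega) hik hkn (by omega)).2 ⟨hlt, hdn, hk d k hd le_rfl hkn⟩
  refine hmin d hd ⟨?_, by omega, fun a b ha hdb hb => ?_⟩
  · by_contra hd0
    exact absurd (hupper j (by omega) hj) (not_lt.mpr hjn)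
  · rcases lt_or_ge b k with hbk | hbk
    · exact (hdmin a ha).trans (hupper b hdb hbk)
    · exact hk a b (by omega) hbk hb

/-- A separable word with at least two letters splits as a direct sum or as a skew sum. -/
theorem IsSeparableWord.exists_cut {w : ℕ → ℤ} {n : ℕ} (hn : 2 ≤ n) (hs : IsSeparableWord w n)
    (hw : ∀ i j, i < j → j < n → w i ≠ w j) :
    (∃ c, IsSumCut w n c) ∨ ∃ c, IsSumCut (fun i => -w i) n c := by
  induction n, hn using Nat.le_induction with
  | base =>
    rcases lt_or_gt_of_ne (hw 0 1 one_pos one_lt_two) with h | h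
    · refine Or.inl ⟨1, by omega, by omega, fun i j hi hj hj' => ?_⟩
      obtain rfl : i = 0 := by omega
      obtain rfl : j = 1 := by omega
      exact h
    · refine Or.inr ⟨1, by omega, by omega, fun i j hi hj hj' => ?_⟩
      obtain rfl : i = 0 := by omega
      obtain rfl : j = 1 := by omega
      exact neg_lt_neg h
  | succ n hn ih =>
    have hw' : ∀ i < n, w i ≠ w n := fun i hi => hw i n hi (by omega)
    rcases ih (hs.mono n.le_succ) (fun i j hi hj => hw i j hi (by omega)) with ⟨c, hc⟩ | ⟨c, hc⟩
    · exact exists_cut_succ_of_isSumCut hs hw' hc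
    · have := exists_cut_succ_of_isSumCut hs.neg (fun i hi h => hw' i hi (neg_injective h)) hc
      simpa only [neg_neg, or_comm] using this

/-- Either kind of cut separates the first letter from the last, and the two kinds order them
oppositely. -/
theorem not_isSumCut_neg_of_isSumCut {w : ℕ → ℤ} {n c d : ℕ} (hc : IsSumCut w n c) :
    ¬ IsSumCut (fun i => -w i) n d := by
  rintro ⟨hd0, hdn, hd⟩
  obtain ⟨hc0, hcn, hc⟩ := hc
  have h1 := hc 0 (n - 1) hc0 (by omega) (by omega)
  have h2 := hd 0 (n - 1) hd0 (by omega) (by omega)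
  simp only at h2
  linarith

/-! ### Permutations as words, and complements -/

/-- The one-line notation of a permutation, as an integer word extended by zeros. -/
def permWord {n : ℕ} (σ : Perm (Fin n)) (i : ℕ) : ℤ :=
  if h : i < n then ((σ ⟨i, h⟩ : ℕ) : ℤ) else 0

theorem permWord_of_lt {n : ℕ} (σ : Perm (Fin n)) {i : ℕ} (h : i < n) :
    permWord σ i = ((σ ⟨i, h⟩ : ℕ) : ℤ) := dif_pos h

theorem permWord_ne {n : ℕ} (σ : Perm (Fin n)) (i j : ℕ) (hij : i < j) (hj : j < n) :
    permWord σ i ≠ permWord σ j := by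
  rw [permWord_of_lt σ (hij.trans hj), permWord_of_lt σ hj]
  intro h
  have h' := congrArg Fin.val (σ.injective (Fin.ext (Int.ofNat_inj.mp h)))
  simp only at h'
  omega

theorem mem_separablePerms_iff {n : ℕ} (σ : Perm (Fin n)) :
    σ ∈ separablePerms n ↔ IsSeparableWord (permWord σ) n := by
  constructor
  · intro h i j k l hij hjk hkl hl
    have hk := hkl.trans hl
    have hj := hjk.trans hk
    have hi := hij.trans hj
    rw [permWord_of_lt σ hi, permWord_of_lt σ hj, permWord_of_lt σ hk, permWord_of_lt σ hl]
    have hmono : StrictMono (![⟨i, hi⟩, ⟨j, hj⟩, ⟨k, hk⟩, ⟨l, hl⟩] : Fin 4 → Fin n) := by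
      rw [Fin.strictMono_iff_lt_succ]
      intro a
      fin_cases a <;> simpa
    constructor <;> rintro ⟨h1, h2, h3⟩
    · refine h ![2, 4, 1, 3] (by simp) ⟨_, hmono, fun a b => ?_⟩
      fin_cases a <;> fin_cases b <;> simp <;> omega
    · refine h ![3, 1, 4, 2] (by simp) ⟨_, hmono, fun a b => ?_⟩
      fin_cases a <;> fin_cases b <;> simp <;> omega
  · rintro h p hp ⟨f, hf, hfp⟩
    have hspec := h (f 0) (f 1) (f 2) (f 3) (hf (by decide)) (hf (by decide)) (hf (by decide))
      (f 3).isLt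
    simp only [permWord_of_lt σ (f _).isLt, Fin.eta, Nat.cast_lt, Fin.val_fin_lt] at hspec
    simp only [hfp] at hspec
    rcases hp with rfl | rfl <;> simp at hspec

/-- The complement of a permutation: its values are reversed. -/
def permComplement {n : ℕ} (σ : Perm (Fin n)) : Perm (Fin n) := σ.trans Fin.revPerm

theorem permComplement_involutive {n : ℕ} :
    Function.Involutive (permComplement : Perm (Fin n) → Perm (Fin n)) := fun σ => by
  ext i
  simp [permComplement]

theorem permWord_permComplement {n : ℕ} (σ : Perm (Fin n)) {i : ℕ} (hi : i < n) :
    permWord (permComplement σ) i = n - 1 - permWord σ i := by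
  rw [permWord_of_lt _ hi, permWord_of_lt _ hi]
  simp only [permComplement, Equiv.trans_apply, Fin.revPerm_apply, Fin.val_rev]
  omega

theorem isSumCut_permComplement {n c : ℕ} (σ : Perm (Fin n)) :
    IsSumCut (permWord (permComplement σ)) n c ↔ IsSumCut (fun i => -permWord σ i) n c := by
  refine and_congr_right fun _ => and_congr_right fun hc => ?_
  refine forall₅_congr fun i j hi _ hj => ?_
  rw [permWord_permComplement σ (hi.trans hc), permWord_permComplement σ hj]
  constructor <;> intro h <;> linarith

theorem permComplement_mem_separablePerms {n : ℕ} {σ : Perm (Fin n)}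
    (h : σ ∈ separablePerms n) : permComplement σ ∈ separablePerms n := by
  rw [mem_separablePerms_iff] at h ⊢
  intro i j k l hij hjk hkl hl
  have := h.neg i j k l hij hjk hkl hl
  simp only [neg_lt_neg_iff] at this
  simp only [permWord_permComplement σ hl, permWord_permComplement σ (hkl.trans hl),
    permWord_permComplement σ (hjk.trans (hkl.trans hl)),
    permWord_permComplement σ (hij.trans (hjk.trans (hkl.trans hl)))]
  omega

/-! ### Direct sums of permutations -/

/-- The direct sum of two permutations. -/
def permDirectSum {k m : ℕ} (p : Perm (Fin k) × Perm (Fin m)) : Perm (Fin (k + m)) :=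
  finSumFinEquiv.permCongr (Perm.sumCongrHom (Fin k) (Fin m) p)

theorem permDirectSum_injective {k m : ℕ} :
    Function.Injective (permDirectSum : Perm (Fin k) × Perm (Fin m) → Perm (Fin (k + m))) :=
  (Equiv.injective _).comp Perm.sumCongrHom_injective

theorem permDirectSum_castAdd {k m : ℕ} (p : Perm (Fin k) × Perm (Fin m)) (i : Fin k) :
    permDirectSum p (Fin.castAdd m i) = Fin.castAdd m (p.1 i) := by
  simp [permDirectSum, Equiv.permCongr_apply, Perm.sumCongrHom]

theorem permDirectSum_natAdd {k m : ℕ} (p : Perm (Fin k) × Perm (Fin m)) (i : Fin m) :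
    permDirectSum p (Fin.natAdd k i) = Fin.natAdd k (p.2 i) := by
  simp [permDirectSum, Equiv.permCongr_apply, Perm.sumCongrHom]

theorem permWord_permDirectSum_left {k m : ℕ} (p : Perm (Fin k) × Perm (Fin m)) {i : ℕ}
    (hi : i < k) : permWord (permDirectSum p) i = permWord p.1 i := by
  rw [permWord_of_lt _ hi, permWord_of_lt _ (show i < k + m by omega)]
  exact congrArg (fun x : Fin (k + m) => ((x : ℕ) : ℤ)) (permDirectSum_castAdd p ⟨i, hi⟩)

theorem permWord_permDirectSum_right {k m : ℕ} (p : Perm (Fin k) × Perm (Fin m)) {i : ℕ}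
    (hi : i < m) : permWord (permDirectSum p) (k + i) = k + permWord p.2 i := by
  rw [permWord_of_lt _ hi, permWord_of_lt _ (show k + i < k + m by omega)]
  have := congrArg (fun x : Fin (k + m) => ((x : ℕ) : ℤ)) (permDirectSum_natAdd p ⟨i, hi⟩)
  exact this.trans (Nat.cast_add _ _)

theorem permWord_nonneg {n : ℕ} (σ : Perm (Fin n)) (i : ℕ) : 0 ≤ permWord σ i := by
  unfold permWord
  split <;> omega

theorem permWord_lt {n : ℕ} (σ : Perm (Fin n)) {i : ℕ} (hi : i < n) : permWord σ i < n := by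
  rw [permWord_of_lt σ hi]
  exact_mod_cast (σ _).isLt

theorem permWord_permDirectSum_lt {k m : ℕ} (p : Perm (Fin k) × Perm (Fin m)) {i j : ℕ}
    (hi : i < k) (hkj : k ≤ j) (hj : j < k + m) :
    permWord (permDirectSum p) i < permWord (permDirectSum p) j := by
  obtain ⟨j, rfl⟩ := Nat.exists_eq_add_of_le hkj
  rw [permWord_permDirectSum_left p hi, permWord_permDirectSum_right p (by omega)]
  linarith [permWord_lt p.1 hi, permWord_nonneg p.2 j]

theorem permDirectSum_mem_separablePerms_iff {k m : ℕ} (p : Perm (Fin k) × Perm (Fin m)) :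
    permDirectSum p ∈ separablePerms (k + m) ↔
      p.1 ∈ separablePerms k ∧ p.2 ∈ separablePerms m := by
  simp only [mem_separablePerms_iff]
  constructor
  · refine fun h => ⟨fun a b c d hab hbc hcd hd => ?_, fun a b c d hab hbc hcd hd => ?_⟩
    · have := h a b c d hab hbc hcd (by omega)
      rwa [permWord_permDirectSum_left p (by omega), permWord_permDirectSum_left p (by omega),
        permWord_permDirectSum_left p (by omega), permWord_permDirectSum_left p (by omega)] at this
    · have := h (k + a) (k + b) (k + c) (k + d) (by omega) (by omega) (by omega) (by omega)
      rw [permWord_permDirectSum_right p (by omega), permWord_permDirectSum_right p (by omega),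
        permWord_permDirectSum_right p (by omega), permWord_permDirectSum_right p (by omega)] at this
      simpa only [add_lt_add_iff_left] using this
  · rintro ⟨h1, h2⟩ a b c d hab hbc hcd hd
    rcases lt_or_ge d k with hdk | hdk
    · have := h1 a b c d hab hbc hcd hdk
      rwa [permWord_permDirectSum_left p (by omega), permWord_permDirectSum_left p (by omega),
        permWord_permDirectSum_left p (by omega), permWord_permDirectSum_left p (by omega)]
    -- An occurrence cannot straddle the two blocks, since neither pattern is itself a direct sum.
    rcases lt_or_ge a k with hak | hak
    · have had := permWord_permDirectSum_lt p hak hdk hd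
      rcases lt_or_ge b k with hbk | hbk
      · have hbd := permWord_permDirectSum_lt p hbk hdk hd
        omega
      · have hab := permWord_permDirectSum_lt p hak hbk (by omega)
        have hac := permWord_permDirectSum_lt p hak (hbk.trans hbc.le) (by omega)
        omega
    · obtain ⟨a, rfl⟩ := Nat.exists_eq_add_of_le hak
      obtain ⟨b, rfl⟩ := Nat.exists_eq_add_of_le (hak.trans hab.le)
      obtain ⟨c, rfl⟩ := Nat.exists_eq_add_of_le ((hak.trans hab.le).trans hbc.le)
      obtain ⟨d, rfl⟩ := Nat.exists_eq_add_of_le hdk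
      have := h2 a b c d (by omega) (by omega) (by omega) (by omega)
      rw [permWord_permDirectSum_right p (by omega), permWord_permDirectSum_right p (by omega),
        permWord_permDirectSum_right p (by omega), permWord_permDirectSum_right p (by omega)]
      simpa only [add_lt_add_iff_left] using this

/-- Letters of the right block exceed all those before `c`, so they impose no condition on a cut
inside the left block. -/
theorem isSumCut_permDirectSum_iff {k m c : ℕ} (p : Perm (Fin k) × Perm (Fin m)) (hc : c < k) :
    IsSumCut (permWord (permDirectSum p)) (k + m) c ↔ IsSumCut (permWord p.1) k c := by
  constructor
  · rintro ⟨hc0, -, h⟩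
    refine ⟨hc0, hc, fun i j hi hcj hj => ?_⟩
    have := h i j hi hcj (by omega)
    rwa [permWord_permDirectSum_left p (by omega), permWord_permDirectSum_left p hj] at this
  · rintro ⟨hc0, -, h⟩
    refine ⟨hc0, by omega, fun i j hi hcj hj => ?_⟩
    rcases lt_or_ge j k with hjk | hjk
    · rw [permWord_permDirectSum_left p (by omega), permWord_permDirectSum_left p hjk]
      exact h i j hi hcj hjk
    · exact permWord_permDirectSum_lt p (by omega) hjk hj

theorem isFirstSumCut_permDirectSum_iff {k m : ℕ} (hk : 0 < k) (hm : 0 < m)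
    (p : Perm (Fin k) × Perm (Fin m)) :
    IsFirstSumCut (permWord (permDirectSum p)) (k + m) k ↔ ∀ c, ¬ IsSumCut (permWord p.1) k c := by
  have hcut : IsSumCut (permWord (permDirectSum p)) (k + m) k :=
    ⟨hk, by omega, fun i j hi hkj hj => permWord_permDirectSum_lt p hi hkj hj⟩
  constructor
  · exact fun h c hc => h.2 c hc.2.1 ((isSumCut_permDirectSum_iff p hc.2.1).mpr hc)
  · exact fun h => ⟨hcut, fun c hc hcut' => h c ((isSumCut_permDirectSum_iff p hc).mp hcut')⟩

/-- A permutation of `k + m` letters whose first `k` letters are smaller than the others maps the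
first `k` positions to the first `k` values. -/
theorem apply_castAdd_lt_of_isSumCut {k m : ℕ} {σ : Perm (Fin (k + m))}
    (h : IsSumCut (permWord σ) (k + m) k) (i : Fin k) : (σ (Fin.castAdd m i) : ℕ) < k := by
  by_contra hcon
  have hlarge : ∀ j : Fin m, (σ (Fin.castAdd m i) : ℕ) < σ (Fin.natAdd k j) := fun j => by
    have := h.2.2 i (k + j) i.isLt (by omega) (by omega)
    rw [permWord_of_lt σ (by omega), permWord_of_lt σ (by omega)] at this
    exact_mod_cast this
  -- If a first-block value were at least `k`, the `m` later values would be distinct elements of an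
  -- interval of size `m - 1`.
  have hmaps : Set.MapsTo (fun j : Fin m => (σ (Fin.natAdd k j) : ℕ))
      (Finset.univ : Finset (Fin m)) (Finset.Ico (k + 1) (k + m)) := fun j _ => by
    have := hlarge j
    simp only [Finset.coe_Ico, Set.mem_Ico]
    omega
  have hcard := Finset.card_le_card_of_injOn _ hmaps fun a _ b _ hab =>
    Fin.natAdd_injective m k (σ.injective (Fin.ext hab))
  have := h.2.1
  simp only [Finset.card_univ, Fintype.card_fin, Nat.card_Ico] at hcard
  omega

theorem exists_permDirectSum_eq_of_isSumCut {k m : ℕ} {σ : Perm (Fin (k + m))}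
    (h : IsSumCut (permWord σ) (k + m) k) :
    ∃ p : Perm (Fin k) × Perm (Fin m), permDirectSum p = σ := by
  have hmaps : Set.MapsTo (finSumFinEquiv.symm.permCongr σ)
      (Set.range (Sum.inl : Fin k → Fin k ⊕ Fin m)) (Set.range Sum.inl) := by
    rintro _ ⟨i, rfl⟩
    refine ⟨⟨_, apply_castAdd_lt_of_isSumCut h i⟩, ?_⟩
    apply finSumFinEquiv.injective
    ext
    simp [Equiv.permCongr_apply]
  obtain ⟨p, hp⟩ := Perm.mem_sumCongrHom_range_of_perm_mapsTo_inl hmaps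
  refine ⟨p, ?_⟩
  rw [permDirectSum, hp]
  ext
  simp [Equiv.permCongr_apply]

/-! ### Counting by the first sum cut -/

/-- The separable permutations that do not split as a direct sum. -/
def sumIndecomposables (n : ℕ) : Set (Perm (Fin n)) :=
  {σ | σ ∈ separablePerms n ∧ ∀ c, ¬ IsSumCut (permWord σ) n c}

/-- The separable permutations that split as a direct sum. -/
def sumDecomposables (n : ℕ) : Set (Perm (Fin n)) :=
  {σ | σ ∈ separablePerms n ∧ ∃ c, IsSumCut (permWord σ) n c}

theorem ncard_firstSumCut {n k m : ℕ} (hn : n = k + m) (hk : 0 < k) (hm : 0 < m) :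
    {σ : Perm (Fin n) | σ ∈ separablePerms n ∧ IsFirstSumCut (permWord σ) n k}.ncard =
      (sumIndecomposables k).ncard * (separablePerms m).ncard := by
  subst hn
  rw [← Set.ncard_prod, ← Set.ncard_image_of_injective _ permDirectSum_injective]
  congr 1
  ext σ
  constructor
  · rintro ⟨hσ, hcut⟩
    obtain ⟨p, rfl⟩ := exists_permDirectSum_eq_of_isSumCut hcut.1
    rw [permDirectSum_mem_separablePerms_iff] at hσ
    rw [isFirstSumCut_permDirectSum_iff hk hm] at hcut
    exact ⟨p, ⟨⟨hσ.1, hcut⟩, hσ.2⟩, rfl⟩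
  · rintro ⟨p, ⟨⟨h1, hcut⟩, h2⟩, rfl⟩
    exact ⟨(permDirectSum_mem_separablePerms_iff p).mpr ⟨h1, h2⟩,
      (isFirstSumCut_permDirectSum_iff hk hm p).mpr hcut⟩

theorem ncard_sumDecomposables (n : ℕ) :
    (sumDecomposables (n + 2)).ncard = ∑ k ∈ Finset.range (n + 1),
      (sumIndecomposables (k + 1)).ncard * (separablePerms (n + 1 - k)).ncard := by
  classical
  have hunion : sumDecomposables (n + 2) = ⋃ k ∈ Finset.range (n + 1),
      {σ | σ ∈ separablePerms (n + 2) ∧ IsFirstSumCut (permWord σ) (n + 2) (k + 1)} := by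
    ext σ
    simp only [Set.mem_iUnion, sumDecomposables, Set.mem_ofPred_eq, Finset.mem_range]
    constructor
    · rintro ⟨hσ, c, hc⟩
      obtain ⟨k, hk⟩ := exists_isFirstSumCut hc
      obtain ⟨hk0, hkn, -⟩ := hk.1
      refine ⟨k - 1, by omega, hσ, ?_⟩
      rwa [Nat.sub_add_cancel hk0]
    · rintro ⟨k, -, hσ, hk⟩
      exact ⟨hσ, _, hk.1⟩
  rw [hunion, Set.ncard_eq_toFinset_card', ← Finset.sum_congr rfl fun k hk =>
    ncard_firstSumCut (n := n + 2) (k := k + 1) (m := n + 1 - k)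
      (by have := Finset.mem_range.mp hk; omega) k.succ_pos
      (by have := Finset.mem_range.mp hk; omega)]
  simp only [Set.ncard_eq_toFinset_card']
  rw [← Finset.card_biUnion]
  · congr 1
    ext σ
    simp [and_left_comm]
  · intro a _ b _ hab
    refine Finset.disjoint_left.mpr fun σ ha hb => hab ?_
    exact Nat.succ_injective ((Set.mem_toFinset.mp ha).2.unique (Set.mem_toFinset.mp hb).2)

theorem separablePerms_eq_union (n : ℕ) :
    separablePerms n = sumDecomposables n ∪ sumIndecomposables n := by
  ext σ
  simp only [sumDecomposables, sumIndecomposables, Set.mem_union, Set.mem_ofPred_eq,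
    ← not_exists, ← and_or_left, em, and_true]

theorem ncard_separablePerms_eq_add (n : ℕ) :
    (separablePerms n).ncard = (sumDecomposables n).ncard + (sumIndecomposables n).ncard := by
  rw [separablePerms_eq_union]
  refine Set.ncard_union_eq (Set.disjoint_left.mpr ?_)
  rintro σ ⟨-, c, hc⟩ ⟨-, h⟩
  exact h c hc

/-- Complementation is the bijection. The bound is needed: a single letter has no cut of either
kind. -/
theorem ncard_sumIndecomposables_eq {n : ℕ} (hn : 2 ≤ n) :
    (sumIndecomposables n).ncard = (sumDecomposables n).ncard := by
  rw [← Set.ncard_image_of_injective (sumDecomposables n) permComplement_involutive.injective]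
  congr 1
  ext σ
  rw [permComplement_involutive.image_eq_preimage_symm]
  constructor
  · rintro ⟨hσ, h⟩
    refine ⟨permComplement_mem_separablePerms hσ, ?_⟩
    simp only [isSumCut_permComplement]
    exact (((mem_separablePerms_iff σ).mp hσ).exists_cut hn (permWord_ne σ)).resolve_left
      (not_exists.mpr h)
  · rintro ⟨hσ, c, hc⟩
    rw [isSumCut_permComplement] at hc
    have := permComplement_mem_separablePerms hσ
    rw [permComplement_involutive] at this
    exact ⟨this, fun d hd => not_isSumCut_neg_of_isSumCut hd hc⟩

theorem separablePerms_eq_univ {n : ℕ} (hn : n < 4) : separablePerms n = Set.univ := by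
  refine Set.eq_univ_of_forall fun σ => (mem_separablePerms_iff σ).mpr ?_
  intro i j k l hij hjk hkl hl
  omega

theorem ncard_separablePerms_zero : (separablePerms 0).ncard = 1 := by
  simp [separablePerms_eq_univ, Set.ncard_univ]

theorem ncard_separablePerms_one : (separablePerms 1).ncard = 1 := by
  simp [separablePerms_eq_univ, Set.ncard_univ]

theorem ncard_sumIndecomposables_one : (sumIndecomposables 1).ncard = 1 := by
  refine Eq.trans (congrArg Set.ncard (Set.ext fun σ => ?_)) ncard_separablePerms_one
  refine ⟨And.left, fun h => ⟨h, fun c hc => ?_⟩⟩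
  have := hc.1
  have := hc.2.1
  omega

theorem ncard_separablePerms_add_two (n : ℕ) :
    (separablePerms (n + 2)).ncard = (separablePerms (n + 1)).ncard +
      ∑ k ∈ Finset.range (n + 1),
        (separablePerms (k + 1)).ncard * (separablePerms (n + 1 - k)).ncard := by
  -- The `k = 0` terms are peeled off because doubling fails for one letter, where both counts are
  -- 1; this leaves the extra summand `a (n + 1)`.
  rw [ncard_separablePerms_eq_add, ncard_sumIndecomposables_eq (by omega), ncard_sumDecomposables,
    Finset.sum_range_succ', Finset.sum_range_succ' (fun k =>
      (separablePerms (k + 1)).ncard * (separablePerms (n + 1 - k)).ncard)]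
  have hdouble : ∀ k, (separablePerms (k + 1 + 1)).ncard =
      2 * (sumIndecomposables (k + 1 + 1)).ncard := fun k => by
    rw [ncard_separablePerms_eq_add (k + 1 + 1), ← ncard_sumIndecomposables_eq (by omega), two_mul]
  simp only [hdouble _, mul_assoc, ← Finset.mul_sum, Nat.sub_zero]
  rw [zero_add, ncard_sumIndecomposables_one, ncard_separablePerms_one]
  ring

theorem ncard_separablePerms_succ (n : ℕ) :
    (separablePerms (n + 1)).ncard = Nat.largeSchroder n := by
  induction n using Nat.strong_induction_on with
  | _ n ih =>
    cases n with
    | zero => simp [ncard_separablePerms_one]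
    | succ n =>
      rw [ncard_separablePerms_add_two, Nat.largeSchroder_succ, ih n (by omega),
        ← Nat.range_succ_eq_Iic]
      congr 1
      refine Finset.sum_congr rfl fun k hk => ?_
      have hk := Finset.mem_range.mp hk
      rw [ih k (by omega), Nat.sub_add_comm (by omega), ih (n - k) (by omega)]

/-! ### Generating functions -/

/-- The large Schröder numbers, as a power series with rational coefficients. -/
noncomputable def ratLargeSchroderSeries : PowerSeries ℚ :=
  PowerSeries.map (Nat.castRingHom ℚ) PowerSeries.largeSchroderSeries

theorem ratLargeSchroderSeries_eq : ratLargeSchroderSeries =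
    1 + PowerSeries.X * ratLargeSchroderSeries + PowerSeries.X * ratLargeSchroderSeries ^ 2 := by
  have := congrArg (PowerSeries.map (Nat.castRingHom ℚ))
    PowerSeries.largeSchroderSeries_eq_one_add_X_mul_largeSchroderSeries_add_X_mul_largeSchroderSeries_sq
  simp only [map_add, map_mul, map_pow, map_one, PowerSeries.map_X] at this
  exact this

theorem separableGF_eq : separableGF = 1 + PowerSeries.X * ratLargeSchroderSeries := by
  ext n
  cases n with
  | zero => simp [separableGF, ncard_separablePerms_zero]
  | succ n =>
    simp [separableGF, ncard_separablePerms_succ, ratLargeSchroderSeries,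
      PowerSeries.coeff_succ_X_mul, PowerSeries.coeff_one]

theorem IsPrincipalSqrt.unique {F R T : PowerSeries ℚ} (hR : IsPrincipalSqrt R F)
    (hT : IsPrincipalSqrt T F) : R = T := by
  rcases sq_eq_sq_iff_eq_or_eq_neg.mp (hR.1.trans hT.1.symm) with h | h
  · exact h
  · have := congrArg PowerSeries.constantCoeff h
    rw [map_neg, hR.2, hT.2] at this
    norm_num at this

theorem separableGF_quadratic :
    separableGF ^ 2 - (3 - PowerSeries.X) * separableGF + 2 = 0 := by
  rw [separableGF_eq]
  linear_combination (-PowerSeries.X) * ratLargeSchroderSeries_eq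

theorem isPrincipalSqrt_separableGF :
    IsPrincipalSqrt (3 - PowerSeries.X - 2 * separableGF)
      (PowerSeries.X ^ 2 - 6 * PowerSeries.X + 1) := by
  constructor
  -- Completing the square: the discriminant is `(3 - X) ^ 2 - 8`. The constant term `3 - 2 = 1`
  -- then selects the branch.
  · linear_combination 4 * separableGF_quadratic
  · rw [separableGF_eq]
    simp only [map_sub, map_mul, map_add, map_ofNat, map_one, PowerSeries.constantCoeff_X]
    norm_num

theorem mainTheorem1 :
    separableGF ^ 2 - (3 - PowerSeries.X) * separableGF + 2 = 0 ∧
    (∃! R : PowerSeries ℚ,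
      IsPrincipalSqrt R (PowerSeries.X ^ 2 - 6 * PowerSeries.X + 1)) ∧
    (∀ R : PowerSeries ℚ,
      IsPrincipalSqrt R (PowerSeries.X ^ 2 - 6 * PowerSeries.X + 1) →
        separableGF = PowerSeries.C (1 / 2 : ℚ) * (3 - PowerSeries.X - R)) ∧
    (separablePerms 0).ncard = 1 ∧
    (∀ n : ℕ, (separablePerms (n + 1)).ncard = Nat.largeSchroder n) := by
  refine ⟨separableGF_quadratic,
    ⟨_, isPrincipalSqrt_separableGF, fun R hR => hR.unique isPrincipalSqrt_separableGF⟩,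
    fun R hR => ?_, ncard_separablePerms_zero, ncard_separablePerms_succ⟩
  have hhalf : (PowerSeries.C (1 / 2 : ℚ)) * 2 = 1 := by
    rw [← map_ofNat (PowerSeries.C (R := ℚ)) 2, ← map_mul]
    norm_num
  rw [hR.unique isPrincipalSqrt_separableGF]
  linear_combination (-separableGF) * hhalf
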